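/- For a positive integer $n$ let $[n]_q = 1+q+\cdots+q^{n-1}$. For multisets of integers of the same size, written in increasing order as $B=\{b_1\le\cdots\le b_m\}$ and $A=\{a_1\le\cdots\le a_m\}$, write $B\preceq A$ (Gale order) if $b_k\le a_k$ for all $k$. Let $\Phi^+$ be the multiplicative monoid of basic cyclotomic generating functions, i.e. of polynomials with nonnegative integer coefficients of the form $f(q)=\prod_{k=1}^m [a_k]_q/\prod_{k=1}^m [b_k]_q$ with $m\ge 0$ and $a_k,b_k$ positive integers, and let $\Phi^{\mathrm{Gale}}\subseteq\Phi^+$ be the submonoid of those $f$ that have such an expression with $\{b_1,\dots,b_m\}\preceq\{a_1,\dots,a_m\}$. Let $\Bbbk$ be a field. For $m\ge0$, grade $\Bbbk[x_1,\dots,x_m]$ by $\deg x_j=b_j$ with $b_j$ positive integers, let $\theta_1,\dots,\theta_m$ be homogeneous polynomials of positive degrees $\deg\theta_j=a_j$ (as many as there are variables), and put $R=\Bbbk[x_1,\dots,x_m]/(\theta_1,\dots,\theta_m)$ and $\mathrm{Hilb}(R;q)=\sum_{n\ge0}(\dim_{\Bbbk} R_n)\,q^n$. The sequence $\theta_1,\dots,\theta_m$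 is regular if $\theta_i$ is not a zero divisor in $\Bbbk[x_1,\dots,x_m]/(\theta_1,\dots,\theta_{i-1})$ for each $i$, and it is a homogeneous system of parameters (HSOP) if $\Bbbk[x_1,\dots,x_m]$ is a finitely generated $\Bbbk[\theta_1,\dots,\theta_m]$-module. Let $\Phi^{\mathrm{alg}}$ be the set of all Hilbert series $\mathrm{Hilb}(R;q)$ of such quotients $R$ by homogeneous systems of parameters (for all $m$ and all degrees, over the fixed field $\Bbbk$). **Lemma.** 1. Every element of $\Phi^{\mathrm{alg}}$ is a polynomial, and $\Phi^{\mathrm{alg}}$ is a submonoid of the Gale monoid $\Phi^{\mathrm{Gale}}$ under multiplication. 2. If $\theta_1,\dots,\theta_m$ as above is a regular sequence or a homogeneous system of parameters, then $\mathrm{Hilb}(R;q)\in\Phi^{\mathrm{Gale}}$ and $\{b_1,\dots,b_m\}\preceq\{a_1,\dots,a_m\}$; that is, when both lists of degrees are sorted increasingly, $a_k\ge b_k$ for all $k=1,\dots,m$. -/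

import Mathlib

open Polynomial

/-! ### Gale order on multisets -/

/-- Gale order `A ≼ B` on multisets of natural numbers: the two multisets have the same size and,
once both are sorted increasingly, the `k`-th entry of `A` is at most the `k`-th entry of `B`
for every `k`. (`List.Forall₂` forces the two lists to have equal length.) -/
def GaleLE (A B : Multiset ℕ) : Prop :=
  List.Forall₂ (fun a b : ℕ => a ≤ b) A.sort B.sort

theorem forall₂_orderedInsert {a b : ℕ} (hab : a ≤ b) {l₁ l₂ : List ℕ}
    (h : List.Forall₂ (fun a b : ℕ => a ≤ b) l₁ l₂)
    (s₁ : l₁.Pairwise (· ≤ ·)) (s₂ : l₂.Pairwise (· ≤ ·)) :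
    List.Forall₂ (fun a b : ℕ => a ≤ b) (l₁.orderedInsert (· ≤ ·) a)
      (l₂.orderedInsert (· ≤ ·) b) := by
  induction h generalizing a b with
  | nil => simpa using hab
  | @cons x y t₁ t₂ hxy ht ih =>
    have st₁ := s₁.of_cons
    have st₂ := s₂.of_cons
    have e₁ : t₁.orderedInsert (· ≤ ·) x = x :: t₁ := by
      have := List.Pairwise.insertionSort_eq s₁
      rwa [List.insertionSort_cons, List.Pairwise.insertionSort_eq st₁] at this
    have e₂ : t₂.orderedInsert (· ≤ ·) y = y :: t₂ := by
      have := List.Pairwise.insertionSort_eq s₂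
      rwa [List.insertionSort_cons, List.Pairwise.insertionSort_eq st₂] at this
    simp only [List.orderedInsert_cons]
    split_ifs with h₁ h₂ h₂
    · exact .cons hab (.cons hxy ht)
    · refine .cons (h₁.trans hxy) ?_
      rw [← e₁]
      exact ih (by omega) st₁ st₂
    · refine .cons (by omega) ?_
      rw [← e₂]
      exact ih (by omega) st₁ st₂
    · exact .cons hxy (ih hab st₁ st₂)

theorem forall₂_insertionSort {l₁ l₂ : List ℕ}
    (h : List.Forall₂ (fun a b : ℕ => a ≤ b) l₁ l₂) :
    List.Forall₂ (fun a b : ℕ => a ≤ b) (l₁.insertionSort (· ≤ ·))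
      (l₂.insertionSort (· ≤ ·)) := by
  induction h with
  | nil => simp
  | cons hab _ ih =>
    simp only [List.insertionSort_cons]
    exact forall₂_orderedInsert hab ih (List.pairwise_insertionSort _ _)
      (List.pairwise_insertionSort _ _)

theorem sort_add_eq (A C : Multiset ℕ) :
    (A + C).sort = (A.sort ++ C.sort).insertionSort (· ≤ ·) := by
  have h : A + C = ((A.sort ++ C.sort : List ℕ) : Multiset ℕ) := by
    rw [← Multiset.coe_add, Multiset.sort_eq, Multiset.sort_eq]
  conv_lhs => rw [h]
  rw [Multiset.coe_sort, List.mergeSort_eq_insertionSort]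

theorem GaleLE.add {A B C D : Multiset ℕ} (h₁ : GaleLE A B) (h₂ : GaleLE C D) :
    GaleLE (A + C) (B + D) := by
  unfold GaleLE at *
  rw [sort_add_eq, sort_add_eq]
  exact forall₂_insertionSort (List.rel_append h₁ h₂)

/-! ### Cyclotomic generating functions -/

/-- The `q`-integer `[n]_q = 1 + q + ⋯ + q ^ (n - 1)`. -/
noncomputable def qInt (n : ℕ) : ℤ[X] := ∑ i ∈ Finset.range n, X ^ i

/-- `f = ∏_{a ∈ A} [a]_q / ∏_{b ∈ B} [b]_q`, where `A` and `B` are multisets of positive integers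
of the same size. -/
structure IsRationalForm (f : ℤ[X]) (A B : Multiset ℕ) : Prop where
  card_eq : A.card = B.card
  num_pos : ∀ a ∈ A, 0 < a
  den_pos : ∀ b ∈ B, 0 < b
  eq : f * (B.map qInt).prod = (A.map qInt).prod

theorem isRationalForm_one : IsRationalForm 1 0 0 := ⟨rfl, by simp, by simp, by simp⟩

theorem IsRationalForm.mul {f g : ℤ[X]} {A B C D : Multiset ℕ} (hf : IsRationalForm f A B)
    (hg : IsRationalForm g C D) : IsRationalForm (f * g) (A + C) (B + D) where
  card_eq := by simp [hf.card_eq, hg.card_eq]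
  num_pos a ha := (Multiset.mem_add.1 ha).elim (hf.num_pos a) (hg.num_pos a)
  den_pos b hb := (Multiset.mem_add.1 hb).elim (hf.den_pos b) (hg.den_pos b)
  eq := by
    rw [Multiset.map_add, Multiset.prod_add, Multiset.map_add, Multiset.prod_add, ← hf.eq, ← hg.eq]
    ring

theorem coeff_mul_nonneg {f g : ℤ[X]} (hf : ∀ n, 0 ≤ f.coeff n) (hg : ∀ n, 0 ≤ g.coeff n)
    (n : ℕ) : 0 ≤ (f * g).coeff n := by
  rw [Polynomial.coeff_mul]
  exact Finset.sum_nonneg fun x _ => mul_nonneg (hf x.1) (hg x.2)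

theorem coeff_one_nonneg (n : ℕ) : 0 ≤ (1 : ℤ[X]).coeff n := by
  rw [Polynomial.coeff_one]
  split_ifs <;> simp

/-- The monoid `Φ⁺` of basic cyclotomic generating functions: polynomials with nonnegative integer
coefficients that are quotients of products of equally many `q`-integers. -/
noncomputable def basicCGFMonoid : Submonoid ℤ[X] where
  carrier := {f | (∀ n, 0 ≤ f.coeff n) ∧ ∃ A B : Multiset ℕ, IsRationalForm f A B}
  one_mem' := ⟨coeff_one_nonneg, 0, 0, isRationalForm_one⟩
  mul_mem' := by
    rintro f g ⟨hf, A, B, hAB⟩ ⟨hg, C, D, hCD⟩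
    exact ⟨coeff_mul_nonneg hf hg, A + C, B + D, hAB.mul hCD⟩

/-- The Gale monoid: the basic cyclotomic generating functions
`f = ∏_{a ∈ A} [a]_q / ∏_{b ∈ B} [b]_q` such that `B ≼ A` in Gale order. -/
noncomputable def galeMonoid : Submonoid ℤ[X] where
  carrier := {f | f ∈ basicCGFMonoid ∧
    ∃ A B : Multiset ℕ, IsRationalForm f A B ∧ GaleLE B A}
  one_mem' := ⟨basicCGFMonoid.one_mem, 0, 0, isRationalForm_one, by simp [GaleLE]⟩
  mul_mem' := by
    rintro f g ⟨hf, A, B, hAB, h₁⟩ ⟨hg, C, D, hCD, h₂⟩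
    exact ⟨basicCGFMonoid.mul_mem hf hg, A + C, B + D, hAB.mul hCD, h₁.add h₂⟩

/-! ### Weighted polynomial rings and their quotients -/

section Weighted

variable {k : Type*} [Field k] {m : ℕ}

/-- `θ₁, …, θₘ` are homogeneous polynomials of positive degrees `a₁, …, aₘ` in
`k[x₁, …, xₘ]`, graded by `deg xⱼ = bⱼ` with every `bⱼ` positive. -/
structure IsHomogeneousSystem (b a : Fin m → ℕ) (θ : Fin m → MvPolynomial (Fin m) k) : Prop where
  weight_pos : ∀ j, 0 < b j
  degree_pos : ∀ j, 0 < a j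
  homogeneous : ∀ j, MvPolynomial.IsWeightedHomogeneous b (θ j) (a j)

/-- `k[x₁, …, xₘ]` is a finitely generated module over its subalgebra `k[θ₁, …, θₘ]`. For
homogeneous `θ` this says that `θ` is a homogeneous system of parameters. -/
def IsParameterSystem (θ : Fin m → MvPolynomial (Fin m) k) : Prop :=
  Module.Finite (Algebra.adjoin k (Set.range θ)) (MvPolynomial (Fin m) k)

/-- `θᵢ` is not a zero divisor in `k[x₁, …, xₘ] / (θ₁, …, θᵢ₋₁)`, for every `i`. (For homogeneous
`θ` of positive degrees, `k[x₁, …, xₘ] / (θ₁, …, θₘ)` is automatically nonzero.) -/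
def IsRegularSystem (θ : Fin m → MvPolynomial (Fin m) k) : Prop :=
  RingTheory.Sequence.IsWeaklyRegular (MvPolynomial (Fin m) k) (List.ofFn θ)

/-- The degree `n` part of `R = k[x₁, …, xₘ] / (θ₁, …, θₘ)`: the classes of the homogeneous
polynomials of degree `n`. -/
noncomputable def gradedPiece (b : Fin m → ℕ) (θ : Fin m → MvPolynomial (Fin m) k) (n : ℕ) :
    Submodule k (MvPolynomial (Fin m) k ⧸ Ideal.span (Set.range θ)) :=
  (MvPolynomial.weightedHomogeneousSubmodule k b n).map
    (Ideal.Quotient.mkₐ k (Ideal.span (Set.range θ))).toLinearMap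

/-- The Hilbert series `∑ₙ (dim Rₙ) qⁿ` of `R = k[x₁, …, xₘ] / (θ₁, …, θₘ)`. -/
noncomputable def hilbertSeries (b : Fin m → ℕ) (θ : Fin m → MvPolynomial (Fin m) k) :
    PowerSeries ℤ :=
  PowerSeries.mk fun n => (Module.finrank k (gradedPiece b θ n) : ℤ)

end Weighted

/-- The set of all Hilbert series of quotients `k[x₁, …, xₘ] / (θ₁, …, θₘ)`, where `m ≥ 0`, the
variables have arbitrary positive integer degrees and `θ₁, …, θₘ` is a homogeneous system of
parameters. -/
def hsopHilbertSeries (k : Type*) [Field k] : Set (PowerSeries ℤ) :=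
  {F | ∃ (m : ℕ) (b a : Fin m → ℕ) (θ : Fin m → MvPolynomial (Fin m) k),
    IsHomogeneousSystem b a θ ∧ IsParameterSystem θ ∧ F = hilbertSeries b θ}

/-! A homogeneous system of parameters `θ` has a finite-dimensional quotient, so it generates an
ideal primary to the maximal ideal of the local ring at the origin. The variables form a regular
sequence of length `m` there, hence associated primes have dimension at least `m`, while dividing by
one element lowers the dimension by at most one: `θ₁` avoids all associated primes, and induction on
`M / θ₁ M`, which again admits a regular sequence of length `m - 1`, shows that `θ` is regular
locally. Homogeneity carries this back to the polynomial ring.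

Dividing by a regular element of degree `a` multiplies the Hilbert series by `1 - q ^ a`. So for a
regular system it is `∏ [aⱼ] / ∏ [bⱼ]`, and having nonnegative coefficients it is bounded by the
numerator: it is a polynomial, and the quotient is finite-dimensional.

For the Gale inequality fix `t` and set to zero the variables of degree at most `t`. Every `θⱼ` of
degree at most `t` then vanishes, and the remaining `θⱼ` still have a finite-dimensional quotient,
so there are at least as many of them as remaining variables; that is, at most as many `aⱼ` as `bⱼ`
are at most `t`. -/

/-! ### Systems of parameters over local rings -/

section LocalRing

open IsLocalRing RingTheory.Sequence Pointwise

theorem ringKrullDim_quotient_succ_le {S : Type*} [CommRing S] {p q : Ideal S} [p.IsPrime]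
    (hpq : p ≤ q) {x : S} (hxp : x ∉ p) (hxq : x ∈ q) :
    ringKrullDim (S ⧸ q) + 1 ≤ ringKrullDim (S ⧸ p) := by
  refine ringKrullDim_succ_le_of_surjective (Ideal.Quotient.factor hpq)
    (Ideal.Quotient.factor_surjective hpq) (r := Ideal.Quotient.mk p x) ?_ ?_
  · rwa [mem_nonZeroDivisors_iff_ne_zero, Ne, Ideal.Quotient.eq_zero_iff_mem]
  · rwa [Ideal.Quotient.factor_mk, Ideal.Quotient.eq_zero_iff_mem]

theorem ringKrullDim_quotient_le_supportDim {S M : Type*} [CommRing S] [AddCommGroup M]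
    [Module S M] {p : PrimeSpectrum S} (hp : p ∈ Module.support S M) :
    ringKrullDim (S ⧸ p.asIdeal) ≤ Module.supportDim S M := by
  have hsub : PrimeSpectrum.zeroLocus (p.asIdeal : Set S) ⊆ Module.support S M :=
    fun _ hq => Module.mem_support_mono hq hp
  rw [ringKrullDim_quotient]
  exact Order.krullDim_le_of_strictMono (Set.inclusion hsub) fun _ _ h => h

theorem torsionBySet_eq_bot_of_le_smul_top {S M : Type*} [CommRing S] [AddCommGroup M] [Module S M]
    [IsNoetherian S M] {x : S} (hx : x ∈ Ideal.jacobson (⊥ : Ideal S))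
    (hreg : IsSMulRegular M x) {s : Set S}
    (hle : Submodule.torsionBySet S M s ≤ x • (⊤ : Submodule S M)) :
    Submodule.torsionBySet S M s = ⊥ := by
  refine Submodule.eq_bot_of_le_smul_of_le_jacobson_bot (Ideal.span {x}) _
    (IsNoetherian.noetherian _) (fun y hy => ?_) ((Ideal.span_singleton_le_iff_mem _).2 hx)
  obtain ⟨z, -, rfl⟩ := (Submodule.mem_smul_pointwise_iff_exists _ _ _).1 (hle hy)
  refine Submodule.smul_mem_smul (Ideal.mem_span_singleton_self x) ?_
  rw [Submodule.mem_torsionBySet_iff] at hy ⊢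
  refine fun a => hreg ?_
  simpa only [smul_zero, smul_comm x] using hy a

variable {R : Type*} [CommRing R] [IsNoetherianRing R]

-- By Nakayama the nonzero `p`-torsion of `M` is not contained in `xM`, and the class in `M / xM` of
-- a `p`-torsion element outside `xM` is annihilated by both `p` and `x`.
theorem exists_isAssociatedPrime_quotSMulTop {M : Type*} [AddCommGroup M] [Module R M]
    [Module.Finite R M] {x : R} (hx : x ∈ Ideal.jacobson (⊥ : Ideal R))
    (hreg : IsSMulRegular M x) {p : Ideal R} (hp : IsAssociatedPrime p M) :
    ∃ q, IsAssociatedPrime q (QuotSMulTop x M) ∧ p ≤ q ∧ x ∈ q := by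
  have htorsion : Submodule.torsionBySet R M p ≠ ⊥ := by
    obtain ⟨hprime, z, hz⟩ := isAssociatedPrime_iff.1 hp
    refine (Submodule.ne_bot_iff _).2 ⟨z, ?_, ?_⟩
    · rw [Submodule.mem_torsionBySet_iff]
      rintro ⟨a, ha⟩
      rwa [SetLike.mem_coe, hz, Submodule.mem_colon_singleton, Submodule.mem_bot] at ha
    · rintro rfl
      exact hprime.ne_top (by rw [hz]; ext; simp [Submodule.mem_colon_singleton])
  obtain ⟨y, hyp, hyx⟩ := SetLike.not_le_iff_exists.1
    (mt (torsionBySet_eq_bot_of_le_smul_top hx hreg) htorsion)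
  have hy : (Submodule.Quotient.mk y : QuotSMulTop x M) ≠ 0 := by
    rwa [Ne, Submodule.Quotient.mk_eq_zero]
  obtain ⟨q, hq, hle⟩ := exists_le_isAssociatedPrime_of_isNoetherianRing R _ hy
  rw [Submodule.mem_torsionBySet_iff] at hyp
  refine ⟨q, hq, fun a ha => hle ?_, hle ?_⟩ <;>
    rw [Submodule.mem_colon_singleton, Submodule.mem_bot, ← Submodule.Quotient.mk_smul]
  · rw [hyp ⟨a, ha⟩, Submodule.Quotient.mk_zero]
  · rw [Submodule.Quotient.mk_eq_zero]
    exact Submodule.smul_mem_pointwise_smul _ _ _ trivial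

theorem isSMulRegular_iff_forall_isAssociatedPrime {M : Type*} [AddCommGroup M] [Module R M]
    {x : R} : IsSMulRegular M x ↔ ∀ p : Ideal R, IsAssociatedPrime p M → x ∉ p := by
  have h : x ∈ ⋃ p ∈ associatedPrimes R M, (p : Set R) ↔ ¬ IsSMulRegular M x := by
    rw [biUnion_associatedPrimes_eq_compl_regular]
    rfl
  rw [← not_iff_not, ← h, Set.mem_iUnion₂]
  simp only [AssociatedPrimes.mem_iff, SetLike.mem_coe, exists_prop, not_forall, not_not]

theorem length_le_ringKrullDim_quotient_of_isAssociatedPrime {rs : List R} {M : Type*}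
    [AddCommGroup M] [Module R M] [Module.Finite R M] (hrs : IsWeaklyRegular M rs)
    (hmem : ∀ r ∈ rs, r ∈ Ideal.jacobson (⊥ : Ideal R)) {p : Ideal R}
    (hp : IsAssociatedPrime p M) : (rs.length : WithBot ℕ∞) ≤ ringKrullDim (R ⧸ p) := by
  induction rs generalizing M p with
  | nil =>
    have := Ideal.Quotient.nontrivial_iff.2 hp.isPrime.ne_top
    simpa using ringKrullDim_nonneg_of_nontrivial (R := R ⧸ p)
  | cons x xs ih =>
    rw [List.forall_mem_cons] at hmem
    rw [isWeaklyRegular_cons_iff] at hrs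
    obtain ⟨q, hq, hpq, hxq⟩ := exists_isAssociatedPrime_quotSMulTop hmem.1 hrs.1 hp
    have hxp : x ∉ p := isSMulRegular_iff_forall_isAssociatedPrime.1 hrs.1 p hp
    have := hp.isPrime
    calc ((x :: xs).length : WithBot ℕ∞) = xs.length + 1 := by simp
      _ ≤ ringKrullDim (R ⧸ q) + 1 := by gcongr; exact ih hrs.2 hmem.2 hq
      _ ≤ ringKrullDim (R ⧸ p) := ringKrullDim_quotient_succ_le hpq hxp hxq

theorem isSMulRegular_of_supportDim_quotSMulTop_lt {M : Type*} [AddCommGroup M] [Module R M]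
    [Module.Finite R M] {rs : List R} (hrs : IsWeaklyRegular M rs)
    (hmem : ∀ r ∈ rs, r ∈ Ideal.jacobson (⊥ : Ideal R)) {x : R}
    (hdim : Module.supportDim R (QuotSMulTop x M) < rs.length) : IsSMulRegular M x := by
  refine isSMulRegular_iff_forall_isAssociatedPrime.2 fun p hp hxp => ?_
  have hsupp : (⟨p, hp.isPrime⟩ : PrimeSpectrum R) ∈ Module.support R (QuotSMulTop x M) := by
    rw [Module.support_quotSMulTop, Module.support_eq_zeroLocus, ← Submodule.annihilator_top]
    refine ⟨?_, ?_⟩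
    · exact (PrimeSpectrum.mem_zeroLocus _ _).2 hp.annihilator_le
    · rwa [PrimeSpectrum.mem_zeroLocus, Set.singleton_subset_iff]
  have hle := ringKrullDim_quotient_le_supportDim hsupp
  have hge := length_le_ringKrullDim_quotient_of_isAssociatedPrime hrs hmem hp
  exact absurd (hge.trans hle) hdim.not_ge

theorem supportDim_le_supportDim_quotient_ofList_add_length [IsLocalRing R] {θ : List R}
    (hθ : ∀ t ∈ θ, t ∈ maximalIdeal R) {M : Type*} [AddCommGroup M] [Module R M]
    [Module.Finite R M] :
    Module.supportDim R M ≤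
      Module.supportDim R (M ⧸ Ideal.ofList θ • (⊤ : Submodule R M)) + θ.length := by
  induction θ generalizing M with
  | nil =>
    have e : M ≃ₗ[R] M ⧸ Ideal.ofList ([] : List R) • (⊤ : Submodule R M) :=
      (Submodule.quotEquivOfEqBot _ (by rw [Ideal.ofList_nil, Submodule.bot_smul])).symm
    simpa using (Module.supportDim_eq_of_equiv e).le
  | cons t ts ih =>
    rw [List.forall_mem_cons] at hθ
    rw [Module.supportDim_eq_of_equiv (Submodule.quotOfListConsSMulTopEquivQuotSMulTopInner M t ts)]
    calc Module.supportDim R M ≤ Module.supportDim R (QuotSMulTop t M) + 1 :=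
          Module.supportDim_le_supportDim_quotSMulTop_succ hθ.1
      _ ≤ _ + ts.length + 1 := by gcongr; exact ih hθ.2
      _ = _ := by simp [add_assoc]

theorem length_le_supportDim_of_isRegular [IsLocalRing R] {M : Type*} [AddCommGroup M]
    [Module R M] [Module.Finite R M] {rs : List R} (hrs : IsRegular M rs) :
    (rs.length : WithBot ℕ∞) ≤ Module.supportDim R M := by
  have : Nontrivial (M ⧸ Ideal.ofList rs • (⊤ : Submodule R M)) :=
    Submodule.Quotient.nontrivial_iff.2 hrs.top_ne_smul.symm
  have : Nonempty (Module.support R (M ⧸ Ideal.ofList rs • (⊤ : Submodule R M))) :=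
    Module.nonempty_support_of_nontrivial.to_subtype
  rw [← Module.supportDim_add_length_eq_supportDim_of_isRegular rs hrs]
  exact le_add_of_nonneg_left Order.krullDim_nonneg

theorem mem_maximalIdeal_of_isRegular {S : Type*} [CommRing S] [IsLocalRing S] {M : Type*}
    [AddCommGroup M] [Module S M] {rs : List S} (hrs : IsRegular M rs) {r : S} (hr : r ∈ rs) :
    r ∈ maximalIdeal S := by
  refine (mem_maximalIdeal r).2 fun hunit => hrs.top_ne_smul ?_
  rw [Ideal.eq_top_of_isUnit_mem (Ideal.ofList rs) (Ideal.subset_span hr) hunit,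
    Submodule.top_smul]

end LocalRing

section RegularExchange

open IsLocalRing RingTheory.Sequence Pointwise

universe u

variable {R : Type u} [CommRing R] [IsLocalRing R] [IsNoetherianRing R] {M : Type u}
  [AddCommGroup M] [Module R M] [Module.Finite R M]

open CategoryTheory Abelian in
-- The length of regular sequences is detected by the vanishing of `Ext (R / 𝔪) M`, and the long
-- exact sequence of `0 → M → M → M / xM → 0` shifts the vanishing range by one.
theorem exists_isRegular_quotSMulTop {rs : List R} (hrs : IsRegular M rs) {n : ℕ}
    (hn : rs.length = n + 1) {x : R} (hx : x ∈ maximalIdeal R) (hreg : IsSMulRegular M x) :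
    ∃ rs' : List R, rs'.length = n ∧ IsRegular (QuotSMulTop x M) rs' := by
  have := hrs.nontrivial
  have := nontrivial_quotSMulTop_of_mem_maximalIdeal (L := M) hx
  have smul_lt (N : Type u) [AddCommGroup N] [Module R N] [Module.Finite R N] [Nontrivial N] :
      maximalIdeal R • (⊤ : Submodule R N) < ⊤ :=
    (Submodule.top_ne_ideal_smul_of_le_jacobson_annihilator
      (maximalIdeal_le_jacobson _)).symm.lt_top
  have hext := ((ModuleCat.exists_isRegular_tfae (maximalIdeal R) (n + 1) (ModuleCat.of R M)
    (smul_lt M)).out 1 3 rfl rfl).2 ⟨rs, hn, fun _ => mem_maximalIdeal_of_isRegular hrs, hrs⟩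
  obtain ⟨rs', hlen, -, hrs'⟩ := ((ModuleCat.exists_isRegular_tfae (maximalIdeal R) n
    (ModuleCat.of R (QuotSMulTop x M)) (smul_lt _)).out 1 3 rfl rfl).1 fun i hi => by
      have hzero (j : ℕ) (hj : j < n + 1) :=
        AddCommGrpCat.isZero_of_iff_subsingleton.mpr (hext j hj)
      exact AddCommGrpCat.subsingleton_of_isZero <| ShortComplex.Exact.isZero_of_both_zeros
        (Ext.covariant_sequence_exact₃' _
          (IsSMulRegular.smulShortComplex_shortExact (M := ModuleCat.of R M) hreg) i (i + 1) rfl)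
        ((hzero i (by omega)).eq_zero_of_src _) ((hzero (i + 1) (by omega)).eq_zero_of_tgt _)
  exact ⟨rs', hlen, hrs'⟩

theorem isWeaklyRegular_of_supportDim_quotient_le_zero {rs θ : List R} (hrs : IsRegular M rs)
    (hlen : rs.length = θ.length) (hθ : ∀ t ∈ θ, t ∈ maximalIdeal R)
    (hdim : Module.supportDim R (M ⧸ Ideal.ofList θ • (⊤ : Submodule R M)) ≤ 0) :
    IsWeaklyRegular M θ := by
  induction θ generalizing M rs with
  | nil => exact .nil R M
  | cons t ts ih =>
    rw [List.forall_mem_cons] at hθ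
    rw [Module.supportDim_eq_of_equiv
      (Submodule.quotOfListConsSMulTopEquivQuotSMulTopInner M t ts)] at hdim
    have hlt : Module.supportDim R (QuotSMulTop t M) < rs.length :=
      calc Module.supportDim R (QuotSMulTop t M) ≤ _ + ts.length :=
            supportDim_le_supportDim_quotient_ofList_add_length hθ.2
        _ ≤ 0 + ts.length := by gcongr
        _ < rs.length := by rw [hlen, zero_add]; exact_mod_cast Nat.lt_succ_self _
    have ht : IsSMulRegular M t := isSMulRegular_of_supportDim_quotSMulTop_lt hrs.1
      (fun r hr => maximalIdeal_le_jacobson _ (mem_maximalIdeal_of_isRegular hrs hr)) hlt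
    obtain ⟨rs', hlen', hrs'⟩ := exists_isRegular_quotSMulTop hrs hlen hθ.1 ht
    exact .cons ht (ih hrs' hlen' hθ.2 hdim)

end RegularExchange

/-! ### Regular sequences of weighted homogeneous polynomials -/

section RegularSequence

open RingTheory.Sequence

theorem ofList_ofFn_eq_span_range {R : Type*} [Semiring R] {n : ℕ} (θ : Fin n → R) :
    Ideal.ofList (List.ofFn θ) = Ideal.span (Set.range θ) := by
  simp only [Ideal.ofList, List.mem_ofFn]
  rfl

theorem span_range_fin_succ {R : Type*} [Semiring R] {n : ℕ} (θ : Fin (n + 1) → R) :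
    Ideal.span (Set.range θ) =
      Ideal.span (Set.range (θ ∘ Fin.castSucc)) ⊔ Ideal.span {θ (Fin.last n)} := by
  rw [← Ideal.span_union]
  congr 1
  ext x
  simp [Fin.exists_fin_succ', eq_comm, or_comm]

theorem isWeaklyRegular_ofFn_succ_iff {R : Type*} [CommRing R] {n : ℕ} (θ : Fin (n + 1) → R) :
    IsWeaklyRegular R (List.ofFn θ) ↔ IsWeaklyRegular R (List.ofFn (θ ∘ Fin.castSucc)) ∧
      ∀ f, f * θ (Fin.last n) ∈ Ideal.span (Set.range (θ ∘ Fin.castSucc)) →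
        f ∈ Ideal.span (Set.range (θ ∘ Fin.castSucc)) := by
  rw [List.ofFn_succ', List.concat_eq_append, isWeaklyRegular_append_iff,
    isWeaklyRegular_singleton_iff, isSMulRegular_quotient_iff_mem_of_smul_mem]
  simp only [smul_eq_mul, Ideal.mul_top, mul_comm (θ (Fin.last n))]
  rw [← ofList_ofFn_eq_span_range]
  rfl

theorem isWeaklyRegular_ofFn_X {σ k : Type*} [CommRing k] {n : ℕ} {e : Fin n → σ}
    (he : Function.Injective e) :
    IsWeaklyRegular (MvPolynomial σ k)
      (List.ofFn fun i => (MvPolynomial.X (e i) : MvPolynomial σ k)) := by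
  induction n with
  | zero => exact .nil _ _
  | succ n ih =>
    refine (isWeaklyRegular_ofFn_succ_iff _).2
      ⟨ih (he.comp (Fin.castSucc_injective n)), fun f hf => ?_⟩
    have hrange : Set.range ((fun i => (MvPolynomial.X (e i) : MvPolynomial σ k)) ∘ Fin.castSucc) =
        MvPolynomial.X '' Set.range (e ∘ Fin.castSucc) := by
      rw [← Set.range_comp]
      rfl
    rw [hrange, MvPolynomial.mem_ideal_span_X_image] at hf ⊢
    intro d hd
    obtain ⟨_, ⟨j, rfl⟩, hj⟩ := hf (d + Finsupp.single (e (Fin.last n)) 1) (by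
      rwa [MvPolynomial.mem_support_iff, MvPolynomial.coeff_mul_X, ← MvPolynomial.mem_support_iff])
    have hne : e (Fin.last n) ≠ e j.castSucc := he.ne (Fin.castSucc_lt_last j).ne'
    exact ⟨_, ⟨j, rfl⟩, by simpa [Finsupp.single_apply, hne] using hj⟩

end RegularSequence

section WeightedPolynomials

open MvPolynomial

variable {σ k : Type*} [CommSemiring k] {w : σ → ℕ} {f g : MvPolynomial σ k} {d n : ℕ}

theorem weightedHomogeneousComponent_mul_of_right (hg : g.IsWeightedHomogeneous w d) :
    weightedHomogeneousComponent w n (f * g) =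
      if d ≤ n then weightedHomogeneousComponent w (n - d) f * g else 0 := by
  induction f using MvPolynomial.induction_on' with
  | monomial e c =>
    have he := isWeightedHomogeneous_monomial w e c rfl
    rw [weightedHomogeneousComponent_of_mem (he.mul hg), weightedHomogeneousComponent_of_mem he]
    split_ifs <;> first | omega | simp
  | add p q hp hq =>
    rw [add_mul, map_add, hp, hq, map_add]
    split_ifs
    · rw [add_mul]
    · rw [add_zero]

theorem constantCoeff_eq_zero_of_isWeightedHomogeneous (hf : f.IsWeightedHomogeneous w d)
    (hd : 0 < d) : constantCoeff f = 0 :=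
  hf.coeff_eq_zero _ (by simpa using hd.ne)

attribute [local instance] weightedGradedAlgebra

theorem isHomogeneous_span_range {ι : Type*} {θ : ι → MvPolynomial σ k} {a : ι → ℕ}
    (hθ : ∀ j, (θ j).IsWeightedHomogeneous w (a j)) :
    (Ideal.span (Set.range θ)).IsHomogeneous (weightedHomogeneousSubmodule k w) := by
  refine Ideal.homogeneous_span _ _ ?_
  rintro _ ⟨j, rfl⟩
  exact ⟨a j, hθ j⟩

end WeightedPolynomials

section Origin

open MvPolynomial RingTheory.Sequence

attribute [local instance] weightedGradedAlgebra

theorem idealOfVars_eq_ker_constantCoeff (σ k : Type*) [CommRing k] :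
    idealOfVars σ k = RingHom.ker (constantCoeff : MvPolynomial σ k →+* k) := by
  ext f
  rw [RingHom.mem_ker, ← pow_one (idealOfVars σ k), mem_pow_idealOfVars_iff']
  simp [constantCoeff_eq, Finsupp.degree_eq_zero_iff]

instance idealOfVars_isPrime (σ k : Type*) [CommRing k] [IsDomain k] :
    (idealOfVars σ k).IsPrime := by
  rw [idealOfVars_eq_ker_constantCoeff]
  exact RingHom.ker_isPrime _

theorem mem_idealOfVars_iff {σ k : Type*} [CommRing k] {f : MvPolynomial σ k} :
    f ∈ idealOfVars σ k ↔ constantCoeff f = 0 := by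
  rw [idealOfVars_eq_ker_constantCoeff, RingHom.mem_ker]

/-- The local ring of affine space at the origin. Homogeneous ideals are contracted from it, so
questions about homogeneous sequences can be decided there. -/
noncomputable abbrev OriginLocalRing (σ k : Type*) [Field k] : Type _ :=
  Localization.AtPrime (idealOfVars σ k)

variable {σ k : Type*} [Field k] {w : σ → ℕ}

-- A denominator `s` has nonzero constant term, and the degree `n` component of `s * f` is that
-- constant times `f`.
theorem mem_of_algebraMap_mem_map (hw : ∀ i, 0 < w i) {I : Ideal (MvPolynomial σ k)}
    (hI : I.IsHomogeneous (weightedHomogeneousSubmodule k w)) {f : MvPolynomial σ k} {n : ℕ}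
    (hf : f.IsWeightedHomogeneous w n)
    (hmem : algebraMap _ (OriginLocalRing σ k) f ∈ I.map (algebraMap _ (OriginLocalRing σ k))) :
    f ∈ I := by
  obtain ⟨s, hs, hsf⟩ := (IsLocalization.algebraMap_mem_map_algebraMap_iff
    (idealOfVars σ k).primeCompl (OriginLocalRing σ k) _ _).1 hmem
  have hs0 : constantCoeff s ≠ 0 := fun h => hs (mem_idealOfVars_iff.2 h)
  have hCf : MvPolynomial.C (constantCoeff s) * f ∈ I := by
    have := weightedHomogeneousComponent_mem_of_mem k w hI hsf n
    rwa [weightedHomogeneousComponent_mul_of_right hf, if_pos le_rfl, Nat.sub_self,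
      weightedHomogeneousComponent_zero _ fun i => (hw i).ne', ← constantCoeff_eq] at this
  simpa only [← mul_assoc, ← map_mul, inv_mul_cancel₀ hs0, map_one, one_mul] using
    I.mul_mem_left (MvPolynomial.C (constantCoeff s)⁻¹) hCf

theorem isWeaklyRegular_of_isWeaklyRegular_originLocalRing (hw : ∀ i, 0 < w i) {n : ℕ}
    {θ : Fin n → MvPolynomial σ k} {a : Fin n → ℕ}
    (hθ : ∀ j, (θ j).IsWeightedHomogeneous w (a j))
    (hreg : IsWeaklyRegular (OriginLocalRing σ k)
      (List.ofFn (algebraMap _ (OriginLocalRing σ k) ∘ θ))) :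
    IsWeaklyRegular (MvPolynomial σ k) (List.ofFn θ) := by
  induction n with
  | zero => exact .nil _ _
  | succ n ih =>
    rw [isWeaklyRegular_ofFn_succ_iff, Function.comp_assoc, Set.range_comp, ← Ideal.map_span]
      at hreg
    have hI := isHomogeneous_span_range (θ := θ ∘ Fin.castSucc) fun j => hθ j.castSucc
    refine (isWeaklyRegular_ofFn_succ_iff θ).2 ⟨ih (fun j => hθ j.castSucc) hreg.1, fun f hf => ?_⟩
    refine (mem_iff_weightedHomogeneousComponent_mem k w hI f).2 fun d => ?_
    have hfd : weightedHomogeneousComponent w d f * θ (Fin.last n) ∈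
        Ideal.span (Set.range (θ ∘ Fin.castSucc)) := by
      have := weightedHomogeneousComponent_mem_of_mem k w hI hf (d + a (Fin.last n))
      rwa [weightedHomogeneousComponent_mul_of_right (hθ _), if_pos (Nat.le_add_left _ _),
        Nat.add_sub_cancel] at this
    refine mem_of_algebraMap_mem_map hw hI
      (weightedHomogeneousComponent_isWeightedHomogeneous _ _) (hreg.2 _ ?_)
    rw [Function.comp_apply, ← map_mul]
    exact Ideal.mem_map_of_mem _ hfd

theorem ringKrullDim_quotient_map_le {R S : Type*} [CommRing R] [CommRing S] [Algebra R S]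
    (M : Submonoid R) [IsLocalization M S] (I : Ideal R) :
    ringKrullDim (S ⧸ I.map (algebraMap R S)) ≤ ringKrullDim (R ⧸ I) := by
  rw [ringKrullDim_quotient, ringKrullDim_quotient]
  refine Order.krullDim_le_of_strictMono (fun q => ⟨PrimeSpectrum.comap (algebraMap R S) q.1,
    Ideal.map_le_iff_le_comap.1 q.2⟩) ?_
  exact Monotone.strictMono_of_injective (fun _ _ h => Ideal.comap_mono h) fun q q' h =>
    Subtype.ext (PrimeSpectrum.localization_comap_injective S M (congrArg Subtype.val h))

theorem supportDim_originLocalRing_quotient_le_zero (l : List (MvPolynomial σ k))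
    [Module.Finite k (MvPolynomial σ k ⧸ Ideal.ofList l)] :
    Module.supportDim (OriginLocalRing σ k) (OriginLocalRing σ k ⧸
      Ideal.ofList (l.map (algebraMap _ (OriginLocalRing σ k))) •
        (⊤ : Ideal (OriginLocalRing σ k))) ≤ 0 := by
  have : IsArtinianRing (MvPolynomial σ k ⧸ Ideal.ofList l) := .of_finite k _
  rw [smul_eq_mul, Ideal.mul_top, Module.supportDim_quotient_eq_ringKrullDim, ← Ideal.map_ofList]
  exact (ringKrullDim_quotient_map_le (idealOfVars σ k).primeCompl _).trans
    ((Order.krullDimLE_iff 0 _).1 inferInstance)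

theorem algebraMap_mem_maximalIdeal_originLocalRing {l : List (MvPolynomial σ k)}
    (h0 : ∀ f ∈ l, constantCoeff f = 0) :
    ∀ t ∈ l.map (algebraMap _ (OriginLocalRing σ k)),
      t ∈ IsLocalRing.maximalIdeal (OriginLocalRing σ k) := by
  intro t ht
  obtain ⟨f, hf, rfl⟩ := List.mem_map.1 ht
  exact (IsLocalization.AtPrime.to_map_mem_maximal_iff _ (idealOfVars σ k) f).2
    (mem_idealOfVars_iff.2 (h0 f hf))

theorem isRegular_originLocalRing_X {n : ℕ} {e : Fin n → σ} (he : Function.Injective e) :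
    IsRegular (OriginLocalRing σ k)
      ((List.ofFn fun i => MvPolynomial.X (e i)).map
        (algebraMap (MvPolynomial σ k) (OriginLocalRing σ k))) := by
  refine (isWeaklyRegular_ofFn_X he).isRegular_of_isLocalization_of_mem _ (idealOfVars σ k) ?_
  intro r hr
  obtain ⟨j, rfl⟩ := List.mem_ofFn.1 hr
  exact Ideal.subset_span ⟨e j, rfl⟩

theorem card_le_of_finite_quotient [Fintype σ] {ι : Type*} [Fintype ι] {θ : ι → MvPolynomial σ k}
    (h0 : ∀ j, constantCoeff (θ j) = 0)
    [Module.Finite k (MvPolynomial σ k ⧸ Ideal.span (Set.range θ))] :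
    Fintype.card σ ≤ Fintype.card ι := by
  let S := OriginLocalRing σ k
  let xs := (List.ofFn fun i => MvPolynomial.X ((Fintype.equivFin σ).symm i)).map
    (algebraMap (MvPolynomial σ k) S)
  let l := List.ofFn (θ ∘ (Fintype.equivFin ι).symm)
  let θs := l.map (algebraMap (MvPolynomial σ k) S)
  have hxs : IsRegular S xs := isRegular_originLocalRing_X (Fintype.equivFin σ).symm.injective
  have : Module.Finite k (MvPolynomial σ k ⧸ Ideal.ofList l) := by
    rwa [ofList_ofFn_eq_span_range, EquivLike.range_comp θ]
  have hdim : (Fintype.card σ : WithBot ℕ∞) ≤ Fintype.card ι :=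
    calc (Fintype.card σ : WithBot ℕ∞) = xs.length := by simp [xs]
      _ ≤ Module.supportDim S S := length_le_supportDim_of_isRegular hxs
      _ ≤ Module.supportDim S (S ⧸ Ideal.ofList θs • (⊤ : Ideal S)) + θs.length :=
        supportDim_le_supportDim_quotient_ofList_add_length
          (algebraMap_mem_maximalIdeal_originLocalRing (by simp [l, h0]))
      _ ≤ 0 + θs.length := by
        gcongr
        exact supportDim_originLocalRing_quotient_le_zero _
      _ = Fintype.card ι := by simp [θs, l]
  exact_mod_cast hdim

theorem isRegularSystem_of_finite_quotient {m : ℕ} {b a : Fin m → ℕ}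
    {θ : Fin m → MvPolynomial (Fin m) k} (hθ : IsHomogeneousSystem b a θ)
    [Module.Finite k (MvPolynomial (Fin m) k ⧸ Ideal.span (Set.range θ))] :
    IsRegularSystem θ := by
  have : Module.Finite k (MvPolynomial (Fin m) k ⧸ Ideal.ofList (List.ofFn θ)) := by
    rwa [ofList_ofFn_eq_span_range]
  have h0 : ∀ f ∈ List.ofFn θ, constantCoeff f = 0 := List.forall_mem_ofFn_iff.2 fun j =>
    constantCoeff_eq_zero_of_isWeightedHomogeneous (hθ.homogeneous j) (hθ.degree_pos j)
  refine isWeaklyRegular_of_isWeaklyRegular_originLocalRing hθ.weight_pos hθ.homogeneous ?_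
  rw [← List.map_ofFn]
  exact isWeaklyRegular_of_supportDim_quotient_le_zero
    (isRegular_originLocalRing_X Function.injective_id) (by simp)
    (algebraMap_mem_maximalIdeal_originLocalRing h0)
    (supportDim_originLocalRing_quotient_le_zero _)

end Origin

section FiniteQuotient

open MvPolynomial

variable {k : Type*} [Field k]

theorem finite_quotient_span_of_finite_adjoin {P : Type*} [CommRing P] [Algebra k P]
    (ε : P →ₐ[k] k) {s : Set P} (hε : ∀ f ∈ s, ε f = 0) [Module.Finite (Algebra.adjoin k s) P] :
    Module.Finite k (P ⧸ Ideal.span s) := by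
  let A := Algebra.adjoin k s
  have hcomp : (Ideal.Quotient.mkₐ k (Ideal.span s)).comp A.val =
      (Algebra.ofId k _).comp (ε.comp A.val) := by
    refine AlgHom.adjoin_ext fun f hf => ?_
    change Ideal.Quotient.mk (Ideal.span s) f = algebraMap k _ (ε f)
    rw [hε f hf, map_zero, Ideal.Quotient.eq_zero_iff_mem]
    exact Ideal.subset_span hf
  have hval : A.val.Finite := ‹Module.Finite A P›
  have hfin := (AlgHom.Finite.of_surjective _
    (Ideal.Quotient.mkₐ_surjective k (Ideal.span s))).comp hval
  rw [hcomp] at hfin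
  exact RingHom.finite_algebraMap.1 (AlgHom.Finite.of_comp_finite hfin)

theorem IsParameterSystem.finite_quotient {m : ℕ} {θ : Fin m → MvPolynomial (Fin m) k}
    (hθ : IsParameterSystem θ) (h0 : ∀ j, constantCoeff (θ j) = 0) :
    Module.Finite k (MvPolynomial (Fin m) k ⧸ Ideal.span (Set.range θ)) := by
  have : Module.Finite (Algebra.adjoin k (Set.range θ)) (MvPolynomial (Fin m) k) := hθ
  refine finite_quotient_span_of_finite_adjoin (MvPolynomial.aeval 0) ?_
  rintro _ ⟨j, rfl⟩
  rw [MvPolynomial.aeval_zero, h0, map_zero]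

theorem killCompl_eq_zero_of_isWeightedHomogeneous {σ τ R : Type*} [CommSemiring R]
    {w : σ → ℕ} {d : ℕ} (hd : 0 < d) {e : τ → σ} (he : Function.Injective e)
    (hde : ∀ i, d < w (e i)) {f : MvPolynomial σ R} (hf : f.IsWeightedHomogeneous w d) :
    killCompl he f = 0 := by
  rw [f.as_sum, map_sum]
  refine Finset.sum_eq_zero fun u hu => ?_
  have hwu : Finsupp.weight w u = d := hf (mem_support_iff.1 hu)
  have hu0 : u ≠ 0 := by
    rintro rfl
    exact hd.ne (by rwa [map_zero] at hwu)
  obtain ⟨i, hi⟩ := Finsupp.support_nonempty_iff.2 hu0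
  refine killCompl_monomial_eq_zero_of_notMem_range he _ hi ?_
  rintro ⟨j, rfl⟩
  have hle := Finsupp.le_weight_of_ne_zero' w (Finsupp.mem_support_iff.1 hi)
  exact (hde j).not_ge (hle.trans_eq hwu)

theorem constantCoeff_killCompl {σ τ R : Type*} [CommSemiring R] {e : τ → σ}
    (he : Function.Injective e) (f : MvPolynomial σ R) :
    constantCoeff (killCompl he f) = constantCoeff f := by
  have : (MvPolynomial.constantCoeff.comp (killCompl he).toRingHom : MvPolynomial σ R →+* R) =
      MvPolynomial.constantCoeff := by
    refine ringHom_ext (fun r => ?_) fun i => ?_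
    · simp
    · by_cases hi : i ∈ Set.range e <;> simp [killCompl, hi]
  exact DFunLike.congr_fun this f

theorem card_filter_le_of_finite_quotient {m : ℕ} {b a : Fin m → ℕ}
    {θ : Fin m → MvPolynomial (Fin m) k} (hθ : IsHomogeneousSystem b a θ)
    [Module.Finite k (MvPolynomial (Fin m) k ⧸ Ideal.span (Set.range θ))] (t : ℕ) :
    (Finset.univ.filter fun j => a j ≤ t).card ≤ (Finset.univ.filter fun j => b j ≤ t).card := by
  have hval : Function.Injective (Subtype.val : {i // t < b i} → Fin m) := Subtype.val_injective
  let φ := killCompl (R := k) hval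
  let θ' : {j // t < a j} → MvPolynomial {i // t < b i} k := fun j => φ (θ j)
  have hle : Ideal.span (Set.range θ) ≤ (Ideal.span (Set.range θ')).comap φ := by
    rw [Ideal.span_le]
    rintro _ ⟨j, rfl⟩
    by_cases hj : t < a j
    · exact Ideal.subset_span ⟨⟨j, hj⟩, rfl⟩
    · have : φ (θ j) = 0 := killCompl_eq_zero_of_isWeightedHomogeneous (hθ.degree_pos j) hval
        (fun i => (not_lt.1 hj).trans_lt i.2) (hθ.homogeneous j)
      simp [this]
  have hsurj : Function.Surjective φ := fun f => ⟨_, killCompl_rename_app hval f⟩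
  have : Module.Finite k (MvPolynomial {i // t < b i} k ⧸ Ideal.span (Set.range θ')) :=
    .of_surjective (Ideal.quotientMapₐ _ φ hle).toLinearMap
      (Ideal.quotientMap_surjective (H := hle) hsurj)
  have hcard : Fintype.card {i // t < b i} ≤ Fintype.card {j // t < a j} := by
    refine card_le_of_finite_quotient (θ := θ') fun j => ?_
    exact (constantCoeff_killCompl hval _).trans
      (constantCoeff_eq_zero_of_isWeightedHomogeneous (hθ.homogeneous j) (hθ.degree_pos j))
  rw [Fintype.card_subtype, Fintype.card_subtype] at hcard
  have ha := Finset.card_filter_add_card_filter_not (s := Finset.univ) fun j => a j ≤ t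
  have hb := Finset.card_filter_add_card_filter_not (s := Finset.univ) fun j => b j ≤ t
  simp only [not_le] at ha hb
  omega

end FiniteQuotient

/-! ### Hilbert series of graded quotients -/

section HilbertSeries

open MvPolynomial

variable {σ k : Type*} [Field k] {w : σ → ℕ} {I : Ideal (MvPolynomial σ k)}

/-- The degree `n` part of the quotient of a weighted polynomial ring by an arbitrary ideal;
`gradedPiece` is the case of the ideal generated by a system of polynomials. -/
noncomputable def quotientPiece (w : σ → ℕ) (I : Ideal (MvPolynomial σ k)) (n : ℕ) :
    Submodule k (MvPolynomial σ k ⧸ I) :=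
  (weightedHomogeneousSubmodule k w n).map (Ideal.Quotient.mkₐ k I).toLinearMap

/-- The Hilbert series of the quotient of a weighted polynomial ring by an arbitrary ideal;
`hilbertSeries` is the case of the ideal generated by a system of polynomials. -/
noncomputable def quotientHilbertSeries (w : σ → ℕ) (I : Ideal (MvPolynomial σ k)) :
    PowerSeries ℤ :=
  PowerSeries.mk fun n => (Module.finrank k (quotientPiece w I n) : ℤ)

theorem mk_mem_quotientPiece {f : MvPolynomial σ k} {n : ℕ} (hf : f.IsWeightedHomogeneous w n) :
    Ideal.Quotient.mk I f ∈ quotientPiece w I n :=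
  ⟨f, hf, rfl⟩

theorem quotientPiece_fg [Finite σ] (hw : ∀ i, 0 < w i) (I : Ideal (MvPolynomial σ k)) (n : ℕ) :
    (quotientPiece w I n).FG :=
  (weightedHomogeneousSubmodule_fg k w (fun i => (hw i).ne') n).map _

theorem finrank_map_add_finrank_inf_ker {V W : Type*} [AddCommGroup V] [Module k V]
    [AddCommGroup W] [Module k W] (f : V →ₗ[k] W) (p : Submodule k V) [FiniteDimensional k p] :
    Module.finrank k (p.map f) + Module.finrank k ↥(p ⊓ LinearMap.ker f) = Module.finrank k p := by
  have h := (f.domRestrict p).finrank_range_add_finrank_ker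
  rwa [LinearMap.range_domRestrict, LinearMap.ker_domRestrict,
    ← Submodule.finrank_map_subtype_eq, Submodule.map_comap_subtype] at h

attribute [local instance] weightedGradedAlgebra

theorem exists_sub_component_mul_mem_of_mem_sup_span_singleton
    (hI : I.IsHomogeneous (weightedHomogeneousSubmodule k w)) {f t : MvPolynomial σ k} {n : ℕ}
    (hf : f.IsWeightedHomogeneous w n) (hft : f ∈ I ⊔ Ideal.span {t}) :
    ∃ h, f - weightedHomogeneousComponent w n (h * t) ∈ I := by
  obtain ⟨g, hg, _, ht, rfl⟩ := Submodule.mem_sup.1 hft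
  obtain ⟨h, rfl⟩ := Ideal.mem_span_singleton'.1 ht
  refine ⟨h, ?_⟩
  nth_rw 1 [← weightedHomogeneousComponent_eq_self hf]
  rw [map_add, add_sub_cancel_right]
  exact weightedHomogeneousComponent_mem_of_mem k w hI hg n

variable {t : MvPolynomial σ k} {d n : ℕ}

theorem quotientPiece_inf_ker_factor_eq_map
    (hI : I.IsHomogeneous (weightedHomogeneousSubmodule k w))
    (ht : t.IsWeightedHomogeneous w d) (hdn : d ≤ n) :
    quotientPiece w I n ⊓ LinearMap.ker
        (Ideal.Quotient.factorₐ k (le_sup_left : I ≤ I ⊔ Ideal.span {t})).toLinearMap =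
      (quotientPiece w I (n - d)).map (LinearMap.mulRight k (Ideal.Quotient.mk I t)) := by
  apply le_antisymm
  · rintro _ ⟨⟨f, hf, rfl⟩, hker⟩
    obtain ⟨h, hh⟩ := exists_sub_component_mul_mem_of_mem_sup_span_singleton hI hf
      (Ideal.Quotient.eq_zero_iff_mem.1 hker)
    rw [weightedHomogeneousComponent_mul_of_right ht, if_pos hdn] at hh
    exact ⟨_, mk_mem_quotientPiece
      (weightedHomogeneousComponent_isWeightedHomogeneous (n - d) h),
      (map_mul _ _ _).symm.trans (Ideal.Quotient.eq.2 hh).symm⟩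
  · rintro _ ⟨_, ⟨f, hf, rfl⟩, rfl⟩
    refine ⟨⟨f * t, ?_, map_mul (Ideal.Quotient.mkₐ k I) _ _⟩, Ideal.Quotient.eq_zero_iff_mem.2 ?_⟩
    · have hmul := IsWeightedHomogeneous.mul hf ht
      rwa [Nat.sub_add_cancel hdn] at hmul
    · exact Ideal.mul_mem_left _ _ (Ideal.mem_sup_right (Ideal.mem_span_singleton_self t))

theorem quotientPiece_inf_ker_factor_eq_bot
    (hI : I.IsHomogeneous (weightedHomogeneousSubmodule k w))
    (ht : t.IsWeightedHomogeneous w d) (hnd : n < d) :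
    quotientPiece w I n ⊓ LinearMap.ker
      (Ideal.Quotient.factorₐ k (le_sup_left : I ≤ I ⊔ Ideal.span {t})).toLinearMap = ⊥ := by
  rw [eq_bot_iff]
  rintro _ ⟨⟨f, hf, rfl⟩, hker⟩
  obtain ⟨h, hh⟩ := exists_sub_component_mul_mem_of_mem_sup_span_singleton hI hf
    (Ideal.Quotient.eq_zero_iff_mem.1 hker)
  rw [weightedHomogeneousComponent_mul_of_right ht, if_neg hnd.not_ge, sub_zero] at hh
  exact Ideal.Quotient.eq_zero_iff_mem.2 hh

theorem quotientPiece_map_factor {J : Ideal (MvPolynomial σ k)} (hIJ : I ≤ J) :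
    (quotientPiece w I n).map (Ideal.Quotient.factorₐ k hIJ).toLinearMap = quotientPiece w J n := by
  rw [quotientPiece, ← Submodule.map_comp]
  rfl

theorem quotientHilbertSeries_sup_span_singleton [Finite σ] (hw : ∀ i, 0 < w i)
    (hI : I.IsHomogeneous (weightedHomogeneousSubmodule k w)) (ht : t.IsWeightedHomogeneous w d)
    (hreg : ∀ f, f * t ∈ I → f ∈ I) :
    quotientHilbertSeries w (I ⊔ Ideal.span {t}) =
      quotientHilbertSeries w I * (1 - PowerSeries.X ^ d) := by
  have hinj : Function.Injective (LinearMap.mulRight k (Ideal.Quotient.mk I t)) := by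
    rw [injective_iff_map_eq_zero]
    intro y hy
    obtain ⟨f, rfl⟩ := Ideal.Quotient.mk_surjective y
    rw [LinearMap.mulRight_apply, ← map_mul, Ideal.Quotient.eq_zero_iff_mem] at hy
    exact Ideal.Quotient.eq_zero_iff_mem.2 (hreg f hy)
  ext n
  have : FiniteDimensional k (quotientPiece w I n) := .of_fg (quotientPiece_fg hw I n)
  have hrank := finrank_map_add_finrank_inf_ker
    (Ideal.Quotient.factorₐ k (le_sup_left : I ≤ I ⊔ Ideal.span {t})).toLinearMap
    (quotientPiece w I n)
  rw [quotientPiece_map_factor] at hrank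
  rw [mul_sub, mul_one, map_sub, PowerSeries.coeff_mul_X_pow']
  simp only [quotientHilbertSeries, PowerSeries.coeff_mk]
  split_ifs with hdn
  · rw [quotientPiece_inf_ker_factor_eq_map hI ht hdn,
      ← (Submodule.equivMapOfInjective _ hinj _).finrank_eq] at hrank
    omega
  · rw [quotientPiece_inf_ker_factor_eq_bot hI ht (not_le.1 hdn), finrank_bot] at hrank
    omega

theorem quotientHilbertSeries_span_range [Finite σ] (hw : ∀ i, 0 < w i) {r : ℕ} {a : Fin r → ℕ}
    {θ : Fin r → MvPolynomial σ k} (hθ : ∀ j, (θ j).IsWeightedHomogeneous w (a j))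
    (hreg : RingTheory.Sequence.IsWeaklyRegular (MvPolynomial σ k) (List.ofFn θ)) :
    quotientHilbertSeries w (Ideal.span (Set.range θ)) =
      quotientHilbertSeries w (⊥ : Ideal (MvPolynomial σ k)) *
        ∏ j, (1 - PowerSeries.X ^ a j) := by
  induction r with
  | zero => simp
  | succ r ih =>
    obtain ⟨hinit, hlast⟩ := (isWeaklyRegular_ofFn_succ_iff θ).1 hreg
    have hI := isHomogeneous_span_range (θ := θ ∘ Fin.castSucc) fun j => hθ j.castSucc
    rw [span_range_fin_succ, quotientHilbertSeries_sup_span_singleton hw hI (hθ (Fin.last r)) hlast,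
      ih (θ := θ ∘ Fin.castSucc) (fun j => hθ j.castSucc) hinit, Fin.prod_univ_castSucc, mul_assoc]

theorem quotientHilbertSeries_idealOfVars (w : σ → ℕ) :
    quotientHilbertSeries w (idealOfVars σ k) = 1 := by
  have hmk (f : MvPolynomial σ k) : Ideal.Quotient.mk (idealOfVars σ k) f =
      Ideal.Quotient.mk _ (MvPolynomial.C (constantCoeff f)) := by
    rw [Ideal.Quotient.eq, mem_idealOfVars_iff]
    simp
  ext n
  rw [quotientHilbertSeries, PowerSeries.coeff_mk, PowerSeries.coeff_one]
  split_ifs with hn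
  · have : quotientPiece w (idealOfVars σ k) n = Submodule.span k {1} := by
      subst hn
      refine le_antisymm ?_ ?_
      · rintro _ ⟨f, -, rfl⟩
        refine Submodule.mem_span_singleton.2 ⟨constantCoeff f, ?_⟩
        exact (Algebra.algebraMap_eq_smul_one _).symm.trans (hmk f).symm
      · rw [Submodule.span_singleton_le_iff_mem]
        exact mk_mem_quotientPiece (isWeightedHomogeneous_one k w)
    rw [this, finrank_span_singleton one_ne_zero, Nat.cast_one]
  · have : quotientPiece w (idealOfVars σ k) n = ⊥ := by
      rw [eq_bot_iff]
      rintro _ ⟨f, hf, rfl⟩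
      exact Ideal.Quotient.eq_zero_iff_mem.2 (mem_idealOfVars_iff.2
        (constantCoeff_eq_zero_of_isWeightedHomogeneous hf (Nat.pos_of_ne_zero hn)))
    rw [this, finrank_bot, Nat.cast_zero]

theorem finite_quotient_of_coe_eq_quotientHilbertSeries [Finite σ] (hw : ∀ i, 0 < w i) {f : ℤ[X]}
    (hf : (f : PowerSeries ℤ) = quotientHilbertSeries w I) :
    Module.Finite k (MvPolynomial σ k ⧸ I) := by
  have hbot {n : ℕ} (hn : f.natDegree < n) : quotientPiece w I n = ⊥ := by
    have h0 := congrArg (PowerSeries.coeff n) hf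
    rw [Polynomial.coeff_coe, Polynomial.coeff_eq_zero_of_natDegree_lt hn, quotientHilbertSeries,
      PowerSeries.coeff_mk, eq_comm, Nat.cast_eq_zero] at h0
    have : FiniteDimensional k (quotientPiece w I n) := .of_fg (quotientPiece_fg hw I n)
    exact Submodule.finrank_eq_zero.1 h0
  let S : Submodule k (MvPolynomial σ k ⧸ I) :=
    ⨆ n ∈ Finset.range (f.natDegree + 1), quotientPiece w I n
  suffices hS : ∀ g : MvPolynomial σ k, Ideal.Quotient.mk I g ∈ S by
    refine .of_fg_top ?_
    rw [← (eq_top_iff.2 fun y _ => ?_ : S = ⊤)]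
    · exact Submodule.fg_biSup _ _ fun n _ => quotientPiece_fg hw I n
    · obtain ⟨g, rfl⟩ := Ideal.Quotient.mk_surjective y
      exact hS g
  intro g
  induction g using MvPolynomial.induction_on' with
  | monomial e c =>
    have hmem := mk_mem_quotientPiece (I := I) (isWeightedHomogeneous_monomial w e c rfl)
    by_cases hn : Finsupp.weight w e ≤ f.natDegree
    · have hle := le_biSup (quotientPiece w I) (Finset.mem_range_succ_iff.2 hn)
      exact hle hmem
    · rw [hbot (not_le.1 hn), Submodule.mem_bot] at hmem
      rw [hmem]
      exact S.zero_mem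
  | add p q hp hq =>
    rw [map_add]
    exact S.add_mem hp hq

end HilbertSeries

section RationalForm

theorem qInt_mul_one_sub_X (n : ℕ) :
    (qInt n : PowerSeries ℤ) * (1 - PowerSeries.X) = 1 - PowerSeries.X ^ n := by
  have h : qInt n * (1 - X) = 1 - X ^ n := by rw [qInt, mul_comm, mul_neg_geom_sum]
  simpa using congrArg (fun f : ℤ[X] => (f : PowerSeries ℤ)) h

theorem prod_one_sub_X_pow_eq {ι : Type*} [Fintype ι] (c : ι → ℕ) :
    ∏ j, (1 - PowerSeries.X ^ c j : PowerSeries ℤ) =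
      ((∏ j, qInt (c j) : ℤ[X]) : PowerSeries ℤ) * (1 - PowerSeries.X) ^ Fintype.card ι := by
  rw [← Polynomial.coeToPowerSeries.ringHom_apply, map_prod, ← Finset.card_univ,
    ← Finset.prod_const, ← Finset.prod_mul_distrib]
  exact Finset.prod_congr rfl fun j _ => (qInt_mul_one_sub_X _).symm

theorem prod_qInt_coeff_nonneg {ι : Type*} [Fintype ι] (c : ι → ℕ) (n : ℕ) :
    0 ≤ (∏ j, qInt (c j)).coeff n := by
  refine Finset.prod_induction (fun j => qInt (c j)) (fun f : ℤ[X] => ∀ n, 0 ≤ f.coeff n)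
    (fun _ _ => coeff_mul_nonneg) coeff_one_nonneg (fun j _ n => ?_) n
  rw [qInt, Polynomial.finsetSum_coeff]
  refine Finset.sum_nonneg fun i _ => ?_
  rw [Polynomial.coeff_X_pow]
  split_ifs <;> simp

theorem prod_qInt_coeff_zero {ι : Type*} [Fintype ι] {c : ι → ℕ} (hc : ∀ j, 0 < c j) :
    (∏ j, qInt (c j)).coeff 0 = 1 := by
  rw [Polynomial.coeff_zero_prod]
  refine Finset.prod_eq_one fun j _ => ?_
  rw [qInt, Polynomial.finsetSum_coeff, Finset.sum_eq_single 0] <;>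
    simp +contextual [Polynomial.coeff_X_pow, hc j, eq_comm]

theorem prod_qInt_ne_zero {ι : Type*} [Fintype ι] {c : ι → ℕ} (hc : ∀ j, 0 < c j) :
    ((∏ j, qInt (c j) : ℤ[X]) : PowerSeries ℤ) ≠ 0 := by
  rw [Ne, Polynomial.coe_eq_zero_iff]
  intro h
  simpa [h] using prod_qInt_coeff_zero hc

theorem exists_coe_eq_of_mul_coe_eq {R : Type*} [CommSemiring R] [PartialOrder R] [IsOrderedRing R]
    {H : PowerSeries R} {f g : R[X]} (hH : ∀ n, 0 ≤ H.coeff n) (hg : ∀ n, 0 ≤ g.coeff n)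
    (hg0 : g.coeff 0 = 1) (h : H * g = f) : ∃ p : R[X], (p : PowerSeries R) = H := by
  have hle (n : ℕ) : H.coeff n ≤ f.coeff n := by
    rw [← Polynomial.coeff_coe, ← h, PowerSeries.coeff_mul]
    have hmem : (n, 0) ∈ Finset.HasAntidiagonal.antidiagonal n :=
      Finset.HasAntidiagonal.mem_antidiagonal.2 (add_zero n)
    refine le_trans (le_of_eq ?_) (Finset.single_le_sum (fun x _ => mul_nonneg (hH x.1) ?_) hmem)
    · rw [Polynomial.coeff_coe, hg0, mul_one]
    · rw [Polynomial.coeff_coe]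
      exact hg _
  refine ⟨H.trunc (f.natDegree + 1), ?_⟩
  ext n
  rw [Polynomial.coeff_coe, PowerSeries.coeff_trunc]
  split_ifs with hn
  · rfl
  · exact le_antisymm (hH n)
      ((hle n).trans_eq (Polynomial.coeff_eq_zero_of_natDegree_lt (by omega)))

variable {k : Type*} [Field k] {m : ℕ} {b a : Fin m → ℕ} {θ : Fin m → MvPolynomial (Fin m) k}

theorem hilbertSeries_eq_quotientHilbertSeries (b : Fin m → ℕ)
    (θ : Fin m → MvPolynomial (Fin m) k) :
    hilbertSeries b θ = quotientHilbertSeries b (Ideal.span (Set.range θ)) :=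
  rfl

theorem hilbertSeries_coeff_nonneg (b : Fin m → ℕ) (θ : Fin m → MvPolynomial (Fin m) k) (n : ℕ) :
    0 ≤ (hilbertSeries b θ).coeff n := by
  rw [hilbertSeries, PowerSeries.coeff_mk]
  exact Nat.cast_nonneg _

theorem IsRegularSystem.hilbertSeries_mul_prod (hreg : IsRegularSystem θ)
    (hθ : IsHomogeneousSystem b a θ) :
    hilbertSeries b θ * ∏ j, (1 - PowerSeries.X ^ b j) = ∏ j, (1 - PowerSeries.X ^ a j) := by
  -- The variables form a regular sequence with quotient `k`, which gives the Hilbert series of the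
  -- polynomial ring itself.
  have hX := quotientHilbertSeries_span_range (k := k) hθ.weight_pos
    (MvPolynomial.isWeightedHomogeneous_X k b) (isWeaklyRegular_ofFn_X Function.injective_id)
  rw [quotientHilbertSeries_idealOfVars] at hX
  rw [hilbertSeries_eq_quotientHilbertSeries,
    quotientHilbertSeries_span_range hθ.weight_pos hθ.homogeneous hreg, mul_right_comm, ← hX,
    one_mul]

theorem IsRegularSystem.hilbertSeries_mul_prod_qInt (hreg : IsRegularSystem θ)
    (hθ : IsHomogeneousSystem b a θ) :
    hilbertSeries b θ * ((∏ j, qInt (b j) : ℤ[X]) : PowerSeries ℤ) =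
      ((∏ j, qInt (a j) : ℤ[X]) : PowerSeries ℤ) := by
  have hne : (1 - PowerSeries.X : PowerSeries ℤ) ≠ 0 := fun h => by
    simpa using congrArg PowerSeries.constantCoeff h
  have h := hreg.hilbertSeries_mul_prod hθ
  rw [prod_one_sub_X_pow_eq, prod_one_sub_X_pow_eq, ← mul_assoc] at h
  exact mul_right_cancel₀ (pow_ne_zero _ hne) h

theorem IsRegularSystem.exists_hilbertSeries_eq (hreg : IsRegularSystem θ)
    (hθ : IsHomogeneousSystem b a θ) :
    ∃ f : ℤ[X], (f : PowerSeries ℤ) = hilbertSeries b θ ∧ (∀ n, 0 ≤ f.coeff n) ∧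
      IsRationalForm f (Finset.univ.val.map a) (Finset.univ.val.map b) := by
  have h := hreg.hilbertSeries_mul_prod_qInt hθ
  obtain ⟨f, hf⟩ := exists_coe_eq_of_mul_coe_eq (hilbertSeries_coeff_nonneg b θ)
    (prod_qInt_coeff_nonneg b) (prod_qInt_coeff_zero hθ.weight_pos) h
  refine ⟨f, hf, fun n => ?_, by simp, by simpa using hθ.degree_pos, by simpa using hθ.weight_pos,
    Polynomial.coe_injective ℤ ?_⟩
  · rw [← Polynomial.coeff_coe, hf]
    exact hilbertSeries_coeff_nonneg b θ n
  · rw [Polynomial.coe_mul, hf, Multiset.map_map, Multiset.map_map]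
    exact h

theorem IsRegularSystem.finite_quotient (hreg : IsRegularSystem θ)
    (hθ : IsHomogeneousSystem b a θ) :
    Module.Finite k (MvPolynomial (Fin m) k ⧸ Ideal.span (Set.range θ)) := by
  obtain ⟨f, hf, -⟩ := hreg.exists_hilbertSeries_eq hθ
  exact finite_quotient_of_coe_eq_quotientHilbertSeries hθ.weight_pos hf

theorem IsParameterSystem.isRegularSystem (hpar : IsParameterSystem θ)
    (hθ : IsHomogeneousSystem b a θ) : IsRegularSystem θ := by
  have := hpar.finite_quotient fun j =>
    constantCoeff_eq_zero_of_isWeightedHomogeneous (hθ.homogeneous j) (hθ.degree_pos j)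
  exact isRegularSystem_of_finite_quotient hθ

end RationalForm

section GaleOrder

theorem forall₂_le_of_countP_le {α : Type*} [LinearOrder α] : ∀ {l₁ l₂ : List α},
    l₁.length = l₂.length → l₁.Pairwise (· ≤ ·) → l₂.Pairwise (· ≤ ·) →
    (∀ t, l₂.countP (· ≤ t) ≤ l₁.countP (· ≤ t)) → List.Forall₂ (· ≤ ·) l₁ l₂
  | [], [], _, _, _, _ => .nil
  | x :: l₁, y :: l₂, hlen, h₁, h₂, h => by
    have hxy : x ≤ y := by
      have hpos : 0 < (x :: l₁).countP (· ≤ y) := (by simp : 0 < _).trans_le (h y)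
      obtain ⟨z, hz, hzy⟩ := List.countP_pos_iff.1 hpos
      rcases List.mem_cons.1 hz with rfl | hz
      · exact of_decide_eq_true hzy
      · exact (List.rel_of_pairwise_cons h₁ hz).trans (of_decide_eq_true hzy)
    refine .cons hxy
      (forall₂_le_of_countP_le (by simpa using hlen) h₁.of_cons h₂.of_cons fun t => ?_)
    by_cases hyt : y ≤ t
    · simpa [List.countP_cons, hyt, hxy.trans hyt] using h t
    · have hzero : l₂.countP (· ≤ t) = 0 := List.countP_eq_zero.2 fun z hz hzt =>
        hyt ((List.rel_of_pairwise_cons h₂ hz).trans (of_decide_eq_true hzt))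
      exact hzero.trans_le (Nat.zero_le _)

theorem galeLE_of_card_filter_le {ι : Type*} [Fintype ι] {b a : ι → ℕ}
    (h : ∀ t, (Finset.univ.filter fun j => a j ≤ t).card ≤
      (Finset.univ.filter fun j => b j ≤ t).card) :
    GaleLE (Finset.univ.val.map b) (Finset.univ.val.map a) := by
  have hcount (c : ι → ℕ) (t : ℕ) :
      ((Finset.univ.val.map c).sort (· ≤ ·)).countP (· ≤ t) =
        (Finset.univ.filter fun j => c j ≤ t).card := by
    rw [← Multiset.coe_countP, Multiset.sort_eq, Multiset.countP_map]
    rfl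
  refine forall₂_le_of_countP_le (by simp) (Multiset.pairwise_sort _ _)
    (Multiset.pairwise_sort _ _) fun t => ?_
  rw [hcount, hcount]
  exact h t

variable {k : Type*} [Field k] {m : ℕ} {b a : Fin m → ℕ} {θ : Fin m → MvPolynomial (Fin m) k}

theorem IsRegularSystem.galeLE (hreg : IsRegularSystem θ) (hθ : IsHomogeneousSystem b a θ) :
    GaleLE (Finset.univ.val.map b) (Finset.univ.val.map a) := by
  have := hreg.finite_quotient hθ
  exact galeLE_of_card_filter_le (card_filter_le_of_finite_quotient hθ)

theorem IsRegularSystem.exists_mem_galeMonoid (hreg : IsRegularSystem θ)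
    (hθ : IsHomogeneousSystem b a θ) :
    ∃ f ∈ galeMonoid, (f : PowerSeries ℤ) = hilbertSeries b θ := by
  obtain ⟨f, hf, hnonneg, hrat⟩ := hreg.exists_hilbertSeries_eq hθ
  exact ⟨f, ⟨⟨hnonneg, _, _, hrat⟩, _, _, hrat, hreg.galeLE hθ⟩, hf⟩

end GaleOrder

/-! ### Products of systems of parameters -/

section Products

variable {k : Type*} [Field k] {m : ℕ} {b a : Fin m → ℕ} {θ : Fin m → MvPolynomial (Fin m) k}

theorem isIntegral_adjoin_map {k P Q : Type*} [CommRing k] [CommRing P] [CommRing Q] [Algebra k P]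
    [Algebra k Q] (φ : P →ₐ[k] Q) {s : Set P} {t : Set Q} (h : ∀ x ∈ s, φ x ∈ Algebra.adjoin k t)
    {f : P} (hf : IsIntegral (Algebra.adjoin k s) f) : IsIntegral (Algebra.adjoin k t) (φ f) := by
  have hle : Algebra.adjoin k s ≤ (Algebra.adjoin k t).comap φ := Algebra.adjoin_le h
  refine hf.map_of_comp_eq
    ((φ.comp (Algebra.adjoin k s).val).codRestrict (Algebra.adjoin k t)
      fun x => hle x.2).toRingHom (φ : P →+* Q) ?_
  ext x
  rfl

theorem IsParameterSystem.isIntegral (h : IsParameterSystem θ) (f : MvPolynomial (Fin m) k) :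
    IsIntegral (Algebra.adjoin k (Set.range θ)) f := by
  have : Module.Finite (Algebra.adjoin k (Set.range θ)) (MvPolynomial (Fin m) k) := h
  exact IsIntegral.of_finite _ f

theorem isParameterSystem_of_isIntegral_X
    (h : ∀ i, IsIntegral (Algebra.adjoin k (Set.range θ))
      (MvPolynomial.X i : MvPolynomial (Fin m) k)) : IsParameterSystem θ := by
  have : Algebra.IsIntegral (Algebra.adjoin k (Set.range θ)) (MvPolynomial (Fin m) k) := by
    refine ⟨fun f => ?_⟩
    induction f using MvPolynomial.induction_on with
    | C r => exact isIntegral_algebraMap (x := algebraMap k (Algebra.adjoin k (Set.range θ)) r)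
    | add p q hp hq => exact hp.add hq
    | mul_X p i hp => exact hp.mul (h i)
  have : Algebra.FiniteType (Algebra.adjoin k (Set.range θ)) (MvPolynomial (Fin m) k) :=
    Algebra.FiniteType.of_restrictScalars_finiteType k _ _
  exact Algebra.IsIntegral.finite

theorem isWeightedHomogeneous_rename {σ τ R M : Type*} [CommSemiring R] [AddCommMonoid M]
    {e : σ → τ} {w : τ → M} {w' : σ → M} (hw : ∀ i, w (e i) = w' i) {φ : MvPolynomial σ R} {d : M}
    (hφ : φ.IsWeightedHomogeneous w' d) : (MvPolynomial.rename e φ).IsWeightedHomogeneous w d := by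
  intro u hu
  obtain ⟨v, rfl, hv⟩ := MvPolynomial.coeff_rename_ne_zero _ _ _ hu
  rw [← hφ hv, Finsupp.weight, Finsupp.weight, LinearMap.toAddMonoidHom_coe,
    LinearMap.toAddMonoidHom_coe, Finsupp.linearCombination_mapDomain]
  congr 2
  exact funext hw

variable {n : ℕ} {b' a' : Fin n → ℕ} {θ' : Fin n → MvPolynomial (Fin n) k}

/-- The concatenation of two systems of polynomials in disjoint sets of variables, which realises
the product of their Hilbert series. -/
noncomputable def appendSystem (θ : Fin m → MvPolynomial (Fin m) k)
    (θ' : Fin n → MvPolynomial (Fin n) k) : Fin (m + n) → MvPolynomial (Fin (m + n)) k :=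
  Fin.append (fun i => MvPolynomial.rename (Fin.castAdd n) (θ i))
    (fun i => MvPolynomial.rename (Fin.natAdd m) (θ' i))

theorem IsHomogeneousSystem.append (h : IsHomogeneousSystem b a θ)
    (h' : IsHomogeneousSystem b' a' θ') :
    IsHomogeneousSystem (Fin.append b b') (Fin.append a a') (appendSystem θ θ') where
  weight_pos j := by
    refine Fin.addCases (fun i => ?_) (fun i => ?_) j
    · simpa using h.weight_pos i
    · simpa using h'.weight_pos i
  degree_pos j := by
    refine Fin.addCases (fun i => ?_) (fun i => ?_) j
    · simpa using h.degree_pos i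
    · simpa using h'.degree_pos i
  homogeneous j := by
    refine Fin.addCases (fun i => ?_) (fun i => ?_) j
    · rw [appendSystem, Fin.append_left, Fin.append_left]
      exact isWeightedHomogeneous_rename (by simp) (h.homogeneous i)
    · rw [appendSystem, Fin.append_right, Fin.append_right]
      exact isWeightedHomogeneous_rename (by simp) (h'.homogeneous i)

theorem IsParameterSystem.append (h : IsParameterSystem θ) (h' : IsParameterSystem θ') :
    IsParameterSystem (appendSystem θ θ') := by
  refine isParameterSystem_of_isIntegral_X fun j => Fin.addCases (fun i => ?_) (fun i => ?_) j
  · rw [← MvPolynomial.rename_X (R := k) (Fin.castAdd n) i]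
    refine isIntegral_adjoin_map _ ?_ (h.isIntegral _)
    rintro _ ⟨l, rfl⟩
    exact Algebra.subset_adjoin ⟨Fin.castAdd n l, Fin.append_left _ _ _⟩
  · rw [← MvPolynomial.rename_X (R := k) (Fin.natAdd m) i]
    refine isIntegral_adjoin_map _ ?_ (h'.isIntegral _)
    rintro _ ⟨l, rfl⟩
    exact Algebra.subset_adjoin ⟨Fin.natAdd m l, Fin.append_right _ _ _⟩

theorem hilbertSeries_append (h : IsHomogeneousSystem b a θ) (hpar : IsParameterSystem θ)
    (h' : IsHomogeneousSystem b' a' θ') (hpar' : IsParameterSystem θ') :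
    hilbertSeries (Fin.append b b') (appendSystem θ θ') =
      hilbertSeries b θ * hilbertSeries b' θ' := by
  have happ := h.append h'
  have e := (hpar.isRegularSystem h).hilbertSeries_mul_prod_qInt h
  have e' := (hpar'.isRegularSystem h').hilbertSeries_mul_prod_qInt h'
  have eapp := ((hpar.append hpar').isRegularSystem happ).hilbertSeries_mul_prod_qInt happ
  refine mul_right_cancel₀ (prod_qInt_ne_zero happ.weight_pos) (eapp.trans ?_)
  rw [Fin.prod_univ_add, Fin.prod_univ_add]
  simp only [Fin.append_left, Fin.append_right, Polynomial.coe_mul]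
  rw [← e, ← e']
  ring

theorem isHomogeneousSystem_zero : IsHomogeneousSystem (k := k) (m := 0) 0 0 0 :=
  ⟨fun j => j.elim0, fun j => j.elim0, fun j => j.elim0⟩

theorem isParameterSystem_zero : IsParameterSystem (k := k) (m := 0) 0 :=
  isParameterSystem_of_isIntegral_X fun j => j.elim0

theorem hilbertSeries_zero : hilbertSeries (k := k) (m := 0) 0 0 = 1 := by
  simpa using (isParameterSystem_zero (k := k).isRegularSystem
    isHomogeneousSystem_zero).hilbertSeries_mul_prod_qInt isHomogeneousSystem_zero

/-- The monoid of polynomials that are Hilbert series of quotients by homogeneous systems of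
parameters, written `Φ^alg` in the paper. -/
def hsopMonoid (k : Type*) [Field k] : Submonoid ℤ[X] where
  carrier := {f | (f : PowerSeries ℤ) ∈ hsopHilbertSeries k}
  one_mem' := ⟨0, 0, 0, 0, isHomogeneousSystem_zero, isParameterSystem_zero, by
    rw [hilbertSeries_zero, Polynomial.coe_one]⟩
  mul_mem' := by
    rintro f g ⟨m, b, a, θ, h, hpar, hf⟩ ⟨n, b', a', θ', h', hpar', hg⟩
    exact ⟨m + n, _, _, _, h.append h', hpar.append hpar', by
      rw [Polynomial.coe_mul, hf, hg, hilbertSeries_append h hpar h' hpar']⟩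

theorem coe_image_hsopMonoid (k : Type*) [Field k] :
    (fun f : ℤ[X] => (f : PowerSeries ℤ)) '' (hsopMonoid k : Set ℤ[X]) = hsopHilbertSeries k := by
  refine Set.Subset.antisymm (Set.image_subset_iff.2 fun f hf => hf) ?_
  rintro F ⟨m, b, a, θ, hθ, hpar, rfl⟩
  obtain ⟨f, -, hf⟩ := (hpar.isRegularSystem hθ).exists_mem_galeMonoid hθ
  exact ⟨f, ⟨m, b, a, θ, hθ, hpar, hf⟩, hf⟩

theorem hsopMonoid_le_galeMonoid (k : Type*) [Field k] : hsopMonoid k ≤ galeMonoid := by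
  rintro f ⟨m, b, a, θ, hθ, hpar, hf⟩
  obtain ⟨g, hg, hgf⟩ := (hpar.isRegularSystem hθ).exists_mem_galeMonoid hθ
  rwa [Polynomial.coe_injective ℤ (hf.trans hgf.symm)]

end Products

theorem mainTheorem12 (k : Type*) [Field k] :
    -- the Hilbert series of quotients by homogeneous systems of parameters are polynomials and
    -- form a submonoid of the Gale monoid
    (∃ S : Submonoid ℤ[X],
      (fun f : ℤ[X] => (f : PowerSeries ℤ)) '' (S : Set ℤ[X]) = hsopHilbertSeries k ∧
      S ≤ galeMonoid) ∧
    -- the same for an individual homogeneous regular sequence (or system of parameters), together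
    -- with the inequalities `b_k ≤ a_k` between the sorted degrees
    ∀ (m : ℕ) (b a : Fin m → ℕ) (θ : Fin m → MvPolynomial (Fin m) k),
      IsHomogeneousSystem b a θ → (IsRegularSystem θ ∨ IsParameterSystem θ) →
      (∃ f ∈ galeMonoid, (f : PowerSeries ℤ) = hilbertSeries b θ) ∧
      GaleLE (Finset.univ.val.map b) (Finset.univ.val.map a) := by
  refine ⟨⟨hsopMonoid k, coe_image_hsopMonoid k, hsopMonoid_le_galeMonoid k⟩, ?_⟩
  intro m b a θ hθ h
  have hreg : IsRegularSystem θ := h.elim id fun hpar => hpar.isRegularSystem hθ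
  exact ⟨hreg.exists_mem_galeMonoid hθ, hreg.galeLE hθ⟩
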